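/- There is an absolute constant $M>0$ such that the following holds. For every tree $T$ on $t\ge 2$ vertices and every real $\varepsilon>0$ there is an integer $\tau_0$ such that for every integer $\tau\ge\tau_0$ with $t\mid\tau$ there is a real constant $C$ (depending on $T$, $\varepsilon$ and $\tau$) with this property: for every sequence $p=p(n)\in[0,1]$ such that $p(n)>\frac{C\log n}{n}$ for all sufficiently large multiples $n$ of $\tau$, the binomial random graph $G(n,p(n))$ satisfies, with probability tending to $1$ as $n\to\infty$ through multiples of $\tau$, the following: it contains a collection of pairwise edge-disjoint $T$-factors which together cover all but at most an $M\varepsilon$-fraction of its edges. Here a $T$-factor of a graph $G$ is a collection of pairwise vertex-disjoint (not necessarily induced) subgraphs of $G$, each isomorphic to $T$, that together cover all vertices of $G$. -/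

import Mathlib

open Filter Topology

/-- An `H`-factor of `G`: a set `F` of pairwise vertex-disjoint (not necessarily induced) subgraphs
of `G`, each isomorphic to `H`, which together cover all vertices of `G`. -/
structure IsGraphFactor {U V : Type*} (H : SimpleGraph U) (G : SimpleGraph V)
    (F : Set G.Subgraph) : Prop where
  iso : ∀ K ∈ F, Nonempty (K.coe ≃g H)
  disjoint : F.PairwiseDisjoint SimpleGraph.Subgraph.verts
  cover : ∀ v : V, ∃ K ∈ F, v ∈ K.verts

/-- The edges used by a set of subgraphs of `G`. -/
def factorEdges {V : Type*} {G : SimpleGraph V} (F : Set G.Subgraph) : Set (Sym2 V) :=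
  ⋃ K ∈ F, K.edgeSet

/-- All but at most a `δ`-fraction of the edges of the (finite) graph `G` can be covered by a family
`P` of pairwise edge-disjoint `H`-factors of `G`. -/
def AlmostPackedByFactors {U V : Type*} (H : SimpleGraph U) (δ : ℝ) (G : SimpleGraph V) : Prop :=
  ∃ P : Set (Set G.Subgraph),
    (∀ F ∈ P, IsGraphFactor H G F) ∧
    P.PairwiseDisjoint factorEdges ∧
    ((G.edgeSet \ ⋃ F ∈ P, factorEdges F).ncard : ℝ) ≤ δ * (G.edgeSet.ncard : ℝ)

/-! Split the vertices into `τ` blocks of size `m = n / τ`. Edges inside blocks are about a `1/τ ≤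
ε` fraction and are given up. Between two blocks lies a random bipartite graph which, with high
probability, contains `k ≈ (1 - ε) p m` edge-disjoint perfect matchings: the Ore–Ryser condition
(`exists_regular_of_card_le`) gives a `k`-regular subgraph, König (`exists_equivs_of_regular`)
splits it, and Chernoff bounds verify the condition for all pairs of vertex sets at once
(`binomialRandom_real_not_matchings_le`).

To assemble matchings into `T`-factors, place `τ / t` disjoint copies of `T` on the set of blocks.
Choosing one matching for each edge of these copies yields a `T`-factor of the whole graph: a tree
has no cycles, so permutations on its edges come from a potential on its vertices
(`IsTree.exists_potential`), and the potential sorts the matched edges into `m` disjoint copies per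
placed tree. By symmetry every pair of blocks is an edge of the same number `D` of placements
(`exists_card_hits`). Hence the `k` matchings of each pair can be shared equally among its
placements, with fewer than `D` left over (`almostPackedByFactors_of_matchings`). -/

namespace SimpleGraph
open MeasureTheory
open scoped Finset

/-! ### Chernoff bounds for edges inside a fixed set of pairs -/

section Chernoff
variable {V : Type*} [Fintype V] [DecidableEq V] (p : unitInterval)

/-- The moment generating function of the number of edges of `G(V, p)` inside a set of pairs. -/
lemma sum_binomialRandom_real_singleton_mul_pow (E : Finset (Sym2 V)) (hE : ∀ e ∈ E, ¬ e.IsDiag)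
    (x : ℝ) :
    ∑ G : SimpleGraph V, (binomialRandom V p).real {G} * x ^ (G.edgeSet ∩ E).ncard
      = (1 - (p : ℝ) + p * x) ^ #E := by
  classical
  -- Expanding the product over non-diagonal pairs gives one term per set of pairs, that is, per
  -- graph.
  have hprod := Finset.prod_add (fun e : Sym2 V => if e ∈ E then (p : ℝ) * x else p)
    (fun _ => 1 - (p : ℝ)) (Finset.univ.filter fun e : Sym2 V => ¬ e.IsDiag)
  have hleft : ∏ e ∈ Finset.univ.filter (fun e : Sym2 V => ¬ e.IsDiag),
      ((if e ∈ E then (p : ℝ) * x else p) + (1 - (p : ℝ))) = (1 - (p : ℝ) + p * x) ^ #E := by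
    have : E ⊆ Finset.univ.filter fun e : Sym2 V => ¬ e.IsDiag := fun e he => by simp [hE e he]
    rw [← Finset.prod_subset this, ← Finset.prod_const]
    · refine Finset.prod_congr rfl fun e he => ?_
      simp [he]; ring
    · intro e _ he
      simp [he]
  rw [← hleft, hprod]
  refine Finset.sum_bij' (fun G _ => G.edgeFinset) (fun s _ => fromEdgeSet (s : Set (Sym2 V)))
    ?_ ?_ ?_ ?_ ?_
  · intro G _
    simp only [Finset.mem_powerset]
    intro e he
    simpa using G.not_isDiag_of_mem_edgeSet (by simpa using he)
  · simp
  · intro G _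
    simp
  · intro s hs
    ext e
    simp only [Finset.mem_powerset] at hs
    simp only [Set.mem_toFinset, edgeFinset, edgeSet_fromEdgeSet]
    constructor
    · rintro ⟨h, -⟩; simpa using h
    · intro h
      exact ⟨by simpa using h, by simpa using hs h⟩
  · intro G _
    have hsub : G.edgeFinset ⊆ Finset.univ.filter fun e : Sym2 V => ¬ e.IsDiag := by
      intro e he
      simpa using G.not_isDiag_of_mem_edgeSet (by simpa using he)
    have h1 : ∏ e ∈ G.edgeFinset, (if e ∈ E then (p : ℝ) * x else p)
        = (p : ℝ) ^ #G.edgeFinset * x ^ (G.edgeSet ∩ E).ncard := by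
      have : ∀ e, (if e ∈ E then (p : ℝ) * x else p) = p * (if e ∈ E then x else 1) := by
        intro e; split_ifs <;> simp
      simp_rw [this]
      rw [Finset.prod_mul_distrib, Finset.prod_const, ← Finset.prod_filter, Finset.prod_const]
      congr 2
      rw [← Set.ncard_coe_finset]
      congr 1
      ext e; simp
    rw [h1, Finset.prod_const, Finset.card_sdiff_of_subset hsub]
    have hN : #(Finset.univ.filter fun e : Sym2 V => ¬ e.IsDiag) = (Nat.card V).choose 2 := by
      rw [Nat.card_eq_fintype_card, ← Sym2.card_subtype_not_diag, Fintype.card_subtype]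
    rw [hN, measureReal_def, binomialRandom_singleton, ENNReal.toReal_mul, ENNReal.toReal_pow,
      ENNReal.toReal_pow, ← coe_edgeFinset, Set.ncard_coe_finset]
    simp
    ring

/-- Markov's inequality for `exp (l * count)`, with `exp l ≤ 1 + l + l ^ 2` for `|l| ≤ 1`. Both
tails follow by choosing the sign of `l`. -/
lemma binomialRandom_real_le_of_exp (E : Finset (Sym2 V)) (hE : ∀ e ∈ E, ¬ e.IsDiag)
    {l : ℝ} (hl : |l| ≤ 1) (c : ℝ) (A : Set (SimpleGraph V))
    (hA : ∀ G ∈ A, c ≤ l * (G.edgeSet ∩ E).ncard) :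
    (binomialRandom V p).real A ≤ Real.exp (p * #E * (l + l ^ 2) - c) := by
  classical
  have hp0 : (0 : ℝ) ≤ p := p.2.1
  have hp1 : (p : ℝ) ≤ 1 := p.2.2
  have : MeasurableSingletonClass (SimpleGraph V) := ⟨fun G => by
    rw [← measurableEmbedding_edgeSet.measurableSet_image, Set.image_singleton]
    exact measurableSet_singleton _⟩
  have h1 : (binomialRandom V p).real A = ∑ G ∈ A.toFinset, (binomialRandom V p).real {G} := by
    rw [sum_measureReal_singleton]; simp
  have h2 : Real.exp c * (binomialRandom V p).real A ≤ (1 - (p : ℝ) + p * Real.exp l) ^ #E := by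
    rw [← sum_binomialRandom_real_singleton_mul_pow p E hE, h1, Finset.mul_sum]
    refine (Finset.sum_le_sum fun G hG => ?_).trans
      (Finset.sum_le_univ_sum_of_nonneg fun G => by positivity)
    rw [mul_comm, ← Real.exp_nat_mul]
    gcongr
    rw [mul_comm]
    exact hA G (by simpa using hG)
  have h3 : (1 - (p : ℝ) + p * Real.exp l) ^ #E ≤ Real.exp (p * #E * (l + l ^ 2)) := by
    have : (p : ℝ) * #E * (l + l ^ 2) = #E * (p * (l + l ^ 2)) := by ring
    rw [this, Real.exp_nat_mul]
    have hexp := (abs_le.1 (Real.abs_exp_sub_one_sub_id_le hl)).2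
    have hpos := Real.exp_pos l
    gcongr
    have := Real.add_one_le_exp (p * (l + l ^ 2))
    nlinarith
  rw [Real.exp_sub, le_div_iff₀ (Real.exp_pos c), mul_comm]
  exact h2.trans h3

lemma binomialRandom_real_ncard_edgeSet_inter_le (E : Finset (Sym2 V))
    (hE : ∀ e ∈ E, ¬ e.IsDiag) {d : ℝ} (hd0 : 0 ≤ d) (hd : d ≤ 1) :
    (binomialRandom V p).real {G | ((G.edgeSet ∩ E).ncard : ℝ) ≤ (1 - d) * (p * #E)}
      ≤ Real.exp (- (d ^ 2 * (p * #E) / 4)) := by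
  -- The exponent is `p * #E * (l * d + l ^ 2)`, minimised at `l = -d / 2`.
  refine (binomialRandom_real_le_of_exp p E hE (l := -(d / 2)) ?_
    (-(d / 2) * ((1 - d) * (p * #E))) _ ?_).trans (le_of_eq ?_)
  · rw [abs_le]; constructor <;> linarith
  · intro G hG
    exact mul_le_mul_of_nonpos_left hG (by linarith)
  · congr 1; ring

lemma binomialRandom_real_le_ncard_edgeSet_inter (E : Finset (Sym2 V))
    (hE : ∀ e ∈ E, ¬ e.IsDiag) {d : ℝ} (hd0 : 0 ≤ d) (hd : d ≤ 1) :
    (binomialRandom V p).real {G | (1 + d) * (p * #E) ≤ ((G.edgeSet ∩ E).ncard : ℝ)}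
      ≤ Real.exp (- (d ^ 2 * (p * #E) / 4)) := by
  refine (binomialRandom_real_le_of_exp p E hE (l := d / 2) ?_
    (d / 2 * ((1 + d) * (p * #E))) _ ?_).trans (le_of_eq ?_)
  · rw [abs_le]; constructor <;> linarith
  · intro G hG
    exact mul_le_mul_of_nonneg_left hG (by linarith)
  · congr 1; ring

end Chernoff
end SimpleGraph


/-! ### Regular bipartite graphs and perfect matchings -/

section Bipartite
open scoped Finset
variable {α β : Type*} [Fintype α] [Fintype β] [DecidableEq α] [DecidableEq β]

/-- The Ore–Ryser criterion for a `k`-regular spanning subgraph of a bipartite graph. -/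
lemma exists_regular_of_card_le (r : α → β → Prop) [∀ a b, Decidable (r a b)] (k : ℕ)
    (hcard : Fintype.card α = Fintype.card β)
    (h : ∀ (X : Finset α) (Y : Finset β),
      k * (#X + #Y) ≤ #{e ∈ X ×ˢ Y | r e.1 e.2} + k * Fintype.card β) :
    ∃ s : Finset (α × β), (∀ e ∈ s, r e.1 e.2) ∧ (∀ a, #{e ∈ s | e.1 = a} = k) ∧
      ∀ b, #{e ∈ s | e.2 = b} = k := by
  classical
  let E := {e : α × β // r e.1 e.2}
  -- An auxiliary Hall problem: each of the `k` tokens at `a` picks an edge at `a`; each edge picks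
  -- itself or a token at its right end. In a perfect matching, the edges not picking themselves are
  -- those picked by left tokens, and they use up the right tokens. They form the regular subgraph.
  let t : (α × Fin k) ⊕ E → Finset (E ⊕ (β × Fin k)) := Sum.elim
    (fun x => ({e : E | e.1.1 = x.1} : Finset E).disjSum ∅)
    (fun e => ({e} : Finset E).disjSum ({y : β × Fin k | y.1 = e.1.2} : Finset (β × Fin k)))
  obtain ⟨f, hf, hft⟩ := (Finset.all_card_le_biUnion_card_iff_exists_injective t).1 (by
    intro S
    let F : Finset E := {e | Sum.inr e ∈ S}
    let X : Finset α := {a | ∃ i, Sum.inl (a, i) ∈ S}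
    let Z : Finset β := F.image fun e => e.1.2
    have hS : #S ≤ k * #X + #F := by
      have hsub : S ⊆ (X ×ˢ (Finset.univ : Finset (Fin k))).disjSum F := by
        rintro (⟨a, i⟩ | e) hx
        · simp only [Finset.inl_mem_disjSum, Finset.mem_product, Finset.mem_univ, and_true]
          simp only [X, Finset.mem_filter, Finset.mem_univ, true_and]
          exact ⟨i, hx⟩
        · simpa [F] using hx
      refine (Finset.card_le_card hsub).trans ?_
      rw [Finset.card_disjSum, Finset.card_product]
      simp [mul_comm]
    have hN : ({e : E | e.1.1 ∈ X ∨ e ∈ F} : Finset E).disjSum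
        (Z ×ˢ (Finset.univ : Finset (Fin k))) ⊆ S.biUnion t := by
      rintro (e | ⟨b, j⟩) hx
      · simp only [Finset.inl_mem_disjSum, Finset.mem_filter, Finset.mem_univ, true_and] at hx
        rw [Finset.mem_biUnion]
        rcases hx with hx | hx
        · simp only [X, Finset.mem_filter, Finset.mem_univ, true_and] at hx
          obtain ⟨i, hi⟩ := hx
          exact ⟨_, hi, by simp [t]⟩
        · simp only [F, Finset.mem_filter, Finset.mem_univ, true_and] at hx
          exact ⟨_, hx, by simp [t]⟩
      · simp only [Finset.inr_mem_disjSum, Finset.mem_product, Finset.mem_univ, and_true, Z,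
          Finset.mem_image] at hx
        obtain ⟨e, he, rfl⟩ := hx
        simp only [F, Finset.mem_filter, Finset.mem_univ, true_and] at he
        rw [Finset.mem_biUnion]
        exact ⟨_, he, by simp [t]⟩
    have hN' := Finset.card_le_card hN
    rw [Finset.card_disjSum, Finset.card_product, Finset.card_univ, Fintype.card_fin] at hN'
    -- Edges of `F` end in `Z`, so those from `X` to `Zᶜ` are additional neighbours; the hypothesis
    -- for `X` and `Zᶜ` then gives Hall's condition.
    have hcount : #F + #{e ∈ X ×ˢ Zᶜ | r e.1 e.2} ≤ #({e : E | e.1.1 ∈ X ∨ e ∈ F} : Finset E) := by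
      have hmap : #{e ∈ X ×ˢ Zᶜ | r e.1 e.2}
          = #({e : E | e.1.1 ∈ X ∧ e.1.2 ∉ Z} : Finset E) := by
        symm
        refine Finset.card_bij (fun e _ => e.1) ?_ ?_ ?_
        · rintro ⟨e, he⟩ hx
          simpa [he] using hx
        · rintro ⟨e, he⟩ _ ⟨e', he'⟩ _ h
          exact Subtype.ext h
        · intro e he
          simp only [Finset.mem_filter, Finset.mem_product, Finset.mem_compl] at he
          exact ⟨⟨e, he.2⟩, by simpa using he.1, rfl⟩
      rw [hmap, ← Finset.card_union_of_disjoint]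
      · apply Finset.card_le_card
        intro e he
        simp only [Finset.mem_union, Finset.mem_filter, Finset.mem_univ, true_and] at he ⊢
        tauto
      · rw [Finset.disjoint_left]
        intro e he he'
        simp only [Finset.mem_filter, Finset.mem_univ, true_and] at he'
        exact he'.2 (Finset.mem_image_of_mem _ he)
    have hXZ := h X Zᶜ
    have hZ : #Zᶜ + #Z = Fintype.card β := Finset.card_compl_add_card Z
    have : k * #X + k * #Zᶜ + k * #Z = k * #X + k * Fintype.card β := by rw [← hZ]; ring
    have : k * (#X + #Zᶜ) = k * #X + k * #Zᶜ := by ring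
    have : k * #Z = #Z * k := mul_comm _ _
    omega)
  have hbij : Function.Bijective f := by
    rw [Fintype.bijective_iff_injective_and_card]
    refine ⟨hf, ?_⟩
    simp only [Fintype.card_sum, Fintype.card_prod, Fintype.card_fin, hcard]
    omega
  have hl : ∀ x : α × Fin k, ∃ e : E, f (.inl x) = .inl e ∧ e.1.1 = x.1 := by
    intro x
    have := hft (.inl x)
    cases hfx : f (.inl x) with
    | inl e => rw [hfx] at this; exact ⟨e, rfl, by simpa [t] using this⟩
    | inr y => rw [hfx] at this; simp [t] at this
  have hr : ∀ e : E, f (.inr e) = .inl e ∨ ∃ j, f (.inr e) = .inr (e.1.2, j) := by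
    intro e
    have := hft (.inr e)
    cases hfx : f (.inr e) with
    | inl e' => rw [hfx] at this; left; simp [t] at this; rw [this]
    | inr y =>
      rw [hfx] at this; right
      simp [t] at this
      exact ⟨y.2, by rw [← this]⟩
  choose gl hgl hgl1 using hl
  let s : Finset (α × β) := ({e : E | ∃ y, f (.inr e) = .inr y} : Finset E).map
    ⟨Subtype.val, Subtype.val_injective⟩
  have hs : ∀ e : E, e.1 ∈ s ↔ ∃ y, f (.inr e) = .inr y := by
    intro e
    simp [s]
  have hsr : ∀ e ∈ s, r e.1 e.2 := by
    intro e he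
    simp only [s, Finset.mem_map] at he
    obtain ⟨e', -, rfl⟩ := he
    exact e'.2
  refine ⟨s, hsr, fun a => ?_, fun b => ?_⟩
  · rw [← Fintype.card_fin k, ← Finset.card_univ]
    symm
    refine Finset.card_bij (fun i _ => (gl (a, i)).1) ?_ ?_ ?_
    · intro i _
      simp only [Finset.mem_filter, hgl1, and_true]
      rw [hs]
      rcases hr (gl (a, i)) with h1 | ⟨j, h1⟩
      · rw [← hgl] at h1
        simpa using hf h1
      · exact ⟨_, h1⟩
    · intro i _ j _ hij
      have : f (.inl (a, i)) = f (.inl (a, j)) := by rw [hgl, hgl, Subtype.ext hij]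
      simpa using hf this
    · intro e he
      simp only [Finset.mem_filter] at he
      obtain ⟨x, hx⟩ := hbij.2 (.inl (⟨e, hsr e he.1⟩ : E))
      cases x with
      | inl x =>
        have h1 := hgl x
        rw [hx] at h1
        have h2 := Sum.inl_injective h1
        have h3 := hgl1 x
        rw [← h2] at h3
        refine ⟨x.2, Finset.mem_univ _, ?_⟩
        have : (a, x.2) = x := Prod.ext (he.2.symm.trans h3) rfl
        rw [this, ← h2]
      | inr e' =>
        obtain ⟨y, hy⟩ := (hs ⟨e, hsr e he.1⟩).1 he.1
        rcases hr e' with h1 | ⟨j, h1⟩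
        · rw [hx] at h1
          rw [← Sum.inl_injective h1, hy] at hx
          simp at hx
        · rw [hx] at h1; simp at h1
  · rw [← Fintype.card_fin k, ← Finset.card_univ]
    symm
    have hsurj : ∀ j : Fin k, ∃ e : E, f (.inr e) = .inr (b, j) := by
      intro j
      obtain ⟨x, hx⟩ := hbij.2 (.inr (b, j))
      cases x with
      | inl x => rw [hgl] at hx; simp at hx
      | inr e => exact ⟨e, hx⟩
    choose g hg using hsurj
    refine Finset.card_bij (fun j _ => (g j).1) ?_ ?_ ?_
    · intro j _
      simp only [Finset.mem_filter]
      refine ⟨(hs _).2 ⟨_, hg j⟩, ?_⟩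
      rcases hr (g j) with h1 | ⟨i, h1⟩
      · rw [hg] at h1; simp at h1
      · rw [hg] at h1
        have := Sum.inr_injective h1
        exact (congrArg Prod.fst this).symm
    · intro i _ j _ hij
      have h1 := hg i
      rw [Subtype.ext hij, hg j] at h1
      simpa using h1.symm
    · intro e he
      simp only [Finset.mem_filter] at he
      obtain ⟨y, hy⟩ := (hs ⟨e, hsr e he.1⟩).1 he.1
      rcases hr ⟨e, hsr e he.1⟩ with h1 | ⟨j, h1⟩
      · rw [hy] at h1; simp at h1
      · refine ⟨j, Finset.mem_univ _, ?_⟩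
        have h2 := hg j
        simp only [he.2] at h1
        rw [← h1] at h2
        exact congrArg Subtype.val (Sum.inr_injective (hf h2))

/-- Hall's condition by double counting the edges at `X`; the degree is `k + 1` so that it can be
cancelled. -/
lemma exists_equiv_of_regular (k : ℕ) (hcard : Fintype.card α = Fintype.card β)
    (s : Finset (α × β)) (ha : ∀ a, #{e ∈ s | e.1 = a} = k + 1)
    (hb : ∀ b, #{e ∈ s | e.2 = b} = k + 1) : ∃ π : α ≃ β, ∀ a, (a, π a) ∈ s := by
  classical
  let t : α → Finset β := fun a => {b | (a, b) ∈ s}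
  obtain ⟨f, hf, hft⟩ := (Finset.all_card_le_biUnion_card_iff_exists_injective t).1 (by
    intro X
    have h1 : #{e ∈ s | e.1 ∈ X} = #X * (k + 1) := by
      rw [Finset.card_eq_sum_card_fiberwise (f := Prod.fst) (t := X)]
      · rw [Finset.sum_const_nat]
        intro a haX
        rw [← ha a, Finset.filter_filter]
        congr 1
        ext e
        simp only [Finset.mem_filter]
        constructor
        · rintro ⟨h, -, h'⟩; exact ⟨h, h'⟩
        · rintro ⟨h, h'⟩; exact ⟨h, h' ▸ haX, h'⟩
      · intro e he
        simpa using (Finset.mem_filter.1 he).2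
    have h2 : #{e ∈ s | e.2 ∈ X.biUnion t} = #(X.biUnion t) * (k + 1) := by
      rw [Finset.card_eq_sum_card_fiberwise (f := Prod.snd) (t := X.biUnion t)]
      · rw [Finset.sum_const_nat]
        intro b hbX
        rw [← hb b, Finset.filter_filter]
        congr 1
        ext e
        simp only [Finset.mem_filter]
        constructor
        · rintro ⟨h, -, h'⟩; exact ⟨h, h'⟩
        · rintro ⟨h, h'⟩; exact ⟨h, h' ▸ hbX, h'⟩
      · intro e he
        simpa using (Finset.mem_filter.1 he).2
    have h3 : #{e ∈ s | e.1 ∈ X} ≤ #{e ∈ s | e.2 ∈ X.biUnion t} := by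
      apply Finset.card_le_card
      intro e he
      simp only [Finset.mem_filter] at he ⊢
      refine ⟨he.1, Finset.mem_biUnion.2 ⟨e.1, he.2, ?_⟩⟩
      simp [t, he.1]
    rw [h1, h2] at h3
    exact Nat.le_of_mul_le_mul_right h3 (Nat.succ_pos k))
  refine ⟨Equiv.ofBijective f ((Fintype.bijective_iff_injective_and_card f).2 ⟨hf, hcard⟩), ?_⟩
  intro a
  simpa [t] using hft a

/-- König: a `k`-regular bipartite graph splits into `k` perfect matchings. -/
lemma exists_equivs_of_regular (k : ℕ) (hcard : Fintype.card α = Fintype.card β)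
    (s : Finset (α × β)) (ha : ∀ a, #{e ∈ s | e.1 = a} = k)
    (hb : ∀ b, #{e ∈ s | e.2 = b} = k) :
    ∃ π : Fin k → α ≃ β, (∀ l a, (a, π l a) ∈ s) ∧ ∀ a, Function.Injective fun l => π l a := by
  classical
  induction k generalizing s with
  | zero => exact ⟨fun l => l.elim0, fun l => l.elim0, fun a l => l.elim0⟩
  | succ k ih =>
    obtain ⟨π₀, h₀⟩ := exists_equiv_of_regular k hcard s ha hb
    obtain ⟨π, hπ, hinj⟩ := ih (s.filter fun e => π₀ e.1 ≠ e.2) (by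
      intro a
      have : (s.filter fun e => π₀ e.1 ≠ e.2).filter (fun e => e.1 = a)
          = (s.filter fun e => e.1 = a).erase (a, π₀ a) := by
        ext ⟨x, y⟩
        simp only [Finset.mem_filter, Finset.mem_erase, ne_eq, Prod.mk.injEq]
        constructor
        · rintro ⟨⟨h1, h2⟩, rfl⟩
          exact ⟨fun h => h2 h.2.symm, h1, rfl⟩
        · rintro ⟨h1, h2, rfl⟩
          exact ⟨⟨h2, fun h => h1 ⟨rfl, h.symm⟩⟩, rfl⟩
      rw [this, Finset.card_erase_of_mem (by simp [h₀ a]), ha]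
      rfl) (by
      intro b
      have : (s.filter fun e => π₀ e.1 ≠ e.2).filter (fun e => e.2 = b)
          = (s.filter fun e => e.2 = b).erase (π₀.symm b, b) := by
        ext ⟨x, y⟩
        simp only [Finset.mem_filter, Finset.mem_erase, ne_eq, Prod.mk.injEq]
        constructor
        · rintro ⟨⟨h1, h2⟩, rfl⟩
          exact ⟨fun h => h2 (by rw [h.1]; simp), h1, rfl⟩
        · rintro ⟨h1, h2, rfl⟩
          exact ⟨⟨h2, fun h => h1 ⟨by rw [← h]; simp, rfl⟩⟩, rfl⟩
      have hmem := h₀ (π₀.symm b)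
      rw [Equiv.apply_symm_apply] at hmem
      rw [this, Finset.card_erase_of_mem (by simp [hmem]), hb]
      rfl)
    have hne : ∀ l a, π₀ a ≠ π l a := fun l a => (Finset.mem_filter.1 (hπ l a)).2
    refine ⟨Fin.cons π₀ π, fun l a => ?_, fun a => ?_⟩
    · refine Fin.cases ?_ (fun l => ?_) l
      · simpa using h₀ a
      · simpa using (Finset.mem_filter.1 (hπ l a)).1
    · intro l l'
      refine Fin.cases ?_ (fun l => ?_) l <;> refine Fin.cases ?_ (fun l' => ?_) l'
      · simp
      · simp [hne l' a]
      · simp [(hne l a).symm]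
      · intro h
        simp only [Fin.cons_succ] at h
        rw [hinj a h]

lemma exists_equivs_of_card_le (r : α → β → Prop) [∀ a b, Decidable (r a b)] (k : ℕ)
    (hcard : Fintype.card α = Fintype.card β)
    (h : ∀ (X : Finset α) (Y : Finset β),
      k * (#X + #Y) ≤ #{e ∈ X ×ˢ Y | r e.1 e.2} + k * Fintype.card β) :
    ∃ π : Fin k → α ≃ β, (∀ l a, r a (π l a)) ∧ ∀ a, Function.Injective fun l => π l a := by
  obtain ⟨s, hs, ha, hb⟩ := exists_regular_of_card_le r k hcard h
  obtain ⟨π, hπ, hinj⟩ := exists_equivs_of_regular k hcard s ha hb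
  exact ⟨π, fun l a => hs _ (hπ l a), hinj⟩

end Bipartite

namespace SimpleGraph
-- Potentials on trees
section Tree
variable {U : Type*} {T : SimpleGraph U}

/-- Every skew-symmetric group labelling of a tree comes from a vertex potential. -/
lemma IsTree.exists_potential (hT : T.IsTree) {Γ : Type*} [Group Γ] (g : U → U → Γ)
    (hg : ∀ u v, T.Adj u v → g v u = (g u v)⁻¹) :
    ∃ φ : U → Γ, ∀ u v, T.Adj u v → φ v = g u v * φ u := by
  obtain ⟨r⟩ := hT.connected.nonempty
  choose P hP hPu using hT.existsUnique_path r
  let w : ∀ v, T.Walk r v → Γ := fun v p => (p.darts.map fun d => g d.fst d.snd).reverse.prod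
  have hw : ∀ u v (p : T.Walk r u) (h : T.Adj u v), w v (p.concat h) = g u v * w u p := by
    intro u v p h
    simp [w, Walk.darts_concat]
  refine ⟨fun v => w v (P v), fun u v huv => ?_⟩
  -- The potential is the ordered product of labels along the path from the root. Of two adjacent
  -- vertices, one has as its path the path of the other extended by their edge.
  by_cases h : u ∈ (P v).support
  · have := hT.isAcyclic.path_concat (hP u) (hP v) huv h
    simp only [this, hw]
  · have h' := hT.isAcyclic.path_concat (hP v) (hP u) huv.symm
      (hT.isAcyclic.mem_support_of_ne_mem_support_of_adj_of_isPath (hP u) (hP v) huv h)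
    simp only [h', hw, hg u v huv, mul_inv_cancel_left]

end Tree

/-! ### Factors from tilings of the vertex set -/

section Tiling
variable {U V K I : Type*} {T : SimpleGraph U} {G : SimpleGraph V}

/-- The copy of `T` spanned by one tile of a tiling of the vertex set. -/
def tileCopy (Φ : K × U ≃ V) (h : ∀ c u v, T.Adj u v → G.Adj (Φ (c, u)) (Φ (c, v))) (c : K) :
    T.Copy G where
  toHom := ⟨fun u => Φ (c, u), fun {u v} huv => h c u v huv⟩
  injective' := fun u v huv => by simpa using huv

lemma isGraphFactor_range_tileCopy (Φ : K × U ≃ V)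
    (h : ∀ c u v, T.Adj u v → G.Adj (Φ (c, u)) (Φ (c, v))) :
    IsGraphFactor T G (Set.range fun c => (tileCopy Φ h c).toSubgraph) where
  iso := by
    rintro _ ⟨c, rfl⟩
    exact ⟨(tileCopy Φ h c).isoToSubgraph.symm⟩
  disjoint := by
    rintro _ ⟨c, rfl⟩ _ ⟨d, rfl⟩ hcd
    rw [Function.onFun, Set.disjoint_left]
    intro x hx hx'
    obtain ⟨u, hu⟩ : ∃ u, Φ (c, u) = x := by simpa [Copy.toSubgraph, tileCopy] using hx
    obtain ⟨v, hv⟩ : ∃ v, Φ (d, v) = x := by simpa [Copy.toSubgraph, tileCopy] using hx'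
    have := Φ.injective (hu.trans hv.symm)
    simp only [Prod.mk.injEq] at this
    exact hcd (by rw [this.1])
  cover := by
    intro x
    refine ⟨_, ⟨(Φ.symm x).1, rfl⟩, ?_⟩
    simp only [Copy.toSubgraph, tileCopy, Subgraph.map_verts, Subgraph.verts_top, Set.image_univ]
    exact ⟨(Φ.symm x).2, by simp⟩

lemma mem_factorEdges_range_tileCopy (Φ : K × U ≃ V)
    (h : ∀ c u v, T.Adj u v → G.Adj (Φ (c, u)) (Φ (c, v))) (e : Sym2 V) :
    e ∈ factorEdges (Set.range fun c => (tileCopy Φ h c).toSubgraph) ↔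
      ∃ c u v, T.Adj u v ∧ e = s(Φ (c, u), Φ (c, v)) := by
  induction e with
  | h x y =>
    simp only [factorEdges, Set.mem_range, Set.iUnion_exists, Set.iUnion_iUnion_eq', Set.mem_iUnion,
      Subgraph.mem_edgeSet]
    simp only [Copy.toSubgraph, tileCopy, Subgraph.map_adj, Relation.Map, Subgraph.top_adj]
    constructor
    · rintro ⟨c, u, v, huv, rfl, rfl⟩
      exact ⟨c, u, v, huv, rfl⟩
    · rintro ⟨c, u, v, huv, hxy⟩
      rw [Sym2.eq_iff] at hxy
      rcases hxy with ⟨rfl, rfl⟩ | ⟨rfl, rfl⟩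
      · exact ⟨c, u, v, huv, rfl, rfl⟩
      · exact ⟨c, v, u, huv.symm, rfl, rfl⟩

/-- An edge-disjoint family of tilings covering all edges of a large set `W`. -/
lemma almostPackedByFactors_of_tilings [Finite V] (Φ : I → K × U ≃ V)
    (hadj : ∀ x c u v, T.Adj u v → G.Adj (Φ x (c, u)) (Φ x (c, v)))
    (hdisj : ∀ x y c d u v u' v', T.Adj u v → T.Adj u' v' → Φ x (c, u) = Φ y (d, u') →
      Φ x (c, v) = Φ y (d, v') → x = y)
    (W : Set (Sym2 V)) (hW : ∀ e ∈ W, ∃ x c u v, T.Adj u v ∧ e = s(Φ x (c, u), Φ x (c, v)))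
    {δ : ℝ} (hδ : (1 - δ) * (G.edgeSet.ncard : ℝ) ≤ W.ncard) :
    AlmostPackedByFactors T δ G := by
  refine ⟨Set.range fun x => Set.range fun c => (tileCopy (Φ x) (hadj x) c).toSubgraph, ?_, ?_, ?_⟩
  · rintro _ ⟨x, rfl⟩
    exact isGraphFactor_range_tileCopy _ _
  · rintro _ ⟨x, rfl⟩ _ ⟨y, rfl⟩ hxy
    rw [Function.onFun, Set.disjoint_left]
    intro e he he'
    rw [mem_factorEdges_range_tileCopy] at he he'
    obtain ⟨c, u, v, huv, rfl⟩ := he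
    obtain ⟨d, u', v', huv', h⟩ := he'
    rw [Sym2.eq_iff] at h
    have : x = y := by
      rcases h with ⟨h1, h2⟩ | ⟨h1, h2⟩
      · exact hdisj _ _ _ _ _ _ _ _ huv huv' h1 h2
      · exact hdisj _ _ _ _ _ _ _ _ huv huv'.symm h1 h2
    subst this
    exact hxy rfl
  · have hWG : W ⊆ G.edgeSet := by
      intro e he
      obtain ⟨x, c, u, v, huv, rfl⟩ := hW e he
      exact hadj x c u v huv
    have hle : (G.edgeSet \ ⋃ F ∈ Set.range fun x => Set.range fun c =>
        (tileCopy (Φ x) (hadj x) c).toSubgraph, factorEdges F).ncard ≤ (G.edgeSet \ W).ncard := by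
      refine Set.ncard_le_ncard ?_ (Set.toFinite _)
      rintro e ⟨he, he'⟩
      refine ⟨he, fun hWe => he' ?_⟩
      obtain ⟨x, hx⟩ := hW e hWe
      simp only [Set.mem_iUnion]
      exact ⟨_, ⟨x, rfl⟩, (mem_factorEdges_range_tileCopy _ _ _).2 hx⟩
    have hsum := Set.ncard_sdiff_add_ncard_of_subset hWG (Set.toFinite _)
    have h1 : ((G.edgeSet \ W).ncard : ℝ) + W.ncard = G.edgeSet.ncard := by exact_mod_cast hsum
    have h2 : ((G.edgeSet \ ⋃ F ∈ Set.range fun x => Set.range fun c =>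
        (tileCopy (Φ x) (hadj x) c).toSubgraph, factorEdges F).ncard : ℝ) ≤ (G.edgeSet \ W).ncard :=
      by exact_mod_cast hle
    linarith

end Tiling
end SimpleGraph

namespace SimpleGraph
open scoped Finset

/-! ### Placing trees on blocks and lifting them along matchings -/

section Blowup
variable {K U : Type*} (T : SimpleGraph U)

/-- The placement `σ` of disjoint copies of `T` on `B` uses the pair `i, j` as an edge. -/
def Hits {B : Type*} (σ : K × U ≃ B) (i j : B) : Prop :=
  ∃ q u v, T.Adj u v ∧ σ (q, u) = i ∧ σ (q, v) = j

variable {T}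

lemma Hits.symm {B : Type*} {σ : K × U ≃ B} {i j : B} (h : Hits T σ i j) : Hits T σ j i := by
  obtain ⟨q, u, v, huv, hi, hj⟩ := h
  exact ⟨q, v, u, huv.symm, hj, hi⟩

lemma hits_trans {B B' : Type*} (σ : K × U ≃ B) (ρ : B ≃ B') (i j : B) :
    Hits T (σ.trans ρ) (ρ i) (ρ j) ↔ Hits T σ i j := by
  simp [Hits]

/-- Double transitivity of the symmetric group, the symmetry behind `exists_card_hits`. -/
lemma exists_perm_apply_eq {B : Type*} [DecidableEq B] {i j i' j' : B} (h : i ≠ j) (h' : i' ≠ j') :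
    ∃ ρ : Equiv.Perm B, ρ i = i' ∧ ρ j = j' := by
  refine ⟨(Equiv.swap i i').trans (Equiv.swap (Equiv.swap i i' j) j'), ?_, by simp⟩
  rw [Equiv.trans_apply, Equiv.swap_apply_left, Equiv.swap_apply_of_ne_of_ne _ h']
  intro h2
  have : Equiv.swap i i' i = Equiv.swap i i' j := by rwa [Equiv.swap_apply_left]
  exact h ((Equiv.swap i i').injective this)

/-- All pairs are used by the same positive number of placements. -/
lemma exists_card_hits [Finite K] [Nonempty K] [Finite U] {B : Type*} [Finite B]
    (hcard : Nonempty (K × U ≃ B)) {u₀ v₀ : U} (h₀ : T.Adj u₀ v₀) :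
    ∃ D, 0 < D ∧ ∀ i j : B, i ≠ j → Nat.card {σ : K × U ≃ B // Hits T σ i j} = D := by
  classical
  obtain ⟨σ₀⟩ := hcard
  obtain ⟨q₀⟩ := ‹Nonempty K›
  have hne : σ₀ (q₀, u₀) ≠ σ₀ (q₀, v₀) := by simpa using h₀.ne
  refine ⟨Nat.card {σ : K × U ≃ B // Hits T σ (σ₀ (q₀, u₀)) (σ₀ (q₀, v₀))}, ?_, ?_⟩
  · have : Nonempty {σ : K × U ≃ B // Hits T σ (σ₀ (q₀, u₀)) (σ₀ (q₀, v₀))} :=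
      ⟨σ₀, q₀, u₀, v₀, h₀, rfl, rfl⟩
    exact Nat.card_pos
  · intro i j hij
    obtain ⟨ρ, hi, hj⟩ := exists_perm_apply_eq hij hne
    refine Nat.card_congr ⟨fun σ => ⟨σ.1.trans ρ, ?_⟩, fun σ => ⟨σ.1.trans ρ.symm, ?_⟩, ?_, ?_⟩
    · rw [← hi, ← hj, hits_trans]; exact σ.2
    · rw [← ρ.symm_apply_apply i, ← ρ.symm_apply_apply j, hits_trans, hi, hj]; exact σ.2
    · intro σ; ext; simp
    · intro σ; ext; simp

/-- The tiling obtained from a placement `σ` of copies of `T` and permutations of the blocks. -/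
def blowupTiling {B M V : Type*} (σ : K × U ≃ B) (e : B × M ≃ V) (φ : K → U → Equiv.Perm M) :
    (K × M) × U ≃ V :=
  (Equiv.mk (fun x : (K × M) × U => ((x.1.1, x.2), x.1.2)) (fun y => ((y.1.1, y.2), y.1.2))
    (fun _ => rfl) (fun _ => rfl)).trans
    ((Equiv.prodShear σ fun qu => φ qu.1 qu.2).trans e)

@[simp] lemma blowupTiling_apply {B M V : Type*} (σ : K × U ≃ B) (e : B × M ≃ V)
    (φ : K → U → Equiv.Perm M) (q : K) (a : M) (u : U) :
    blowupTiling σ e φ ((q, a), u) = e (σ (q, u), φ q u a) := rfl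

lemma card_prod_lt (τ : ℕ) : #{x : Fin τ × Fin τ | x.1 < x.2} * 2 = τ * (τ - 1) := by
  have h1 : #{x : Fin τ × Fin τ | x.1 < x.2} = ∑ j : Fin τ, (j : ℕ) := by
    rw [Finset.card_filter, Fintype.sum_prod_type_right]
    refine Finset.sum_congr rfl fun j _ => ?_
    rw [← Finset.card_filter]
    conv_rhs => rw [← Fin.card_Iio j]
    congr 1; ext; simp
  rw [h1, Fin.sum_univ_eq_sum_range (fun i => i), Finset.sum_range_id_mul_two]

/-- If all pairs of blocks of `G` carry `k` disjoint perfect matchings, then `G` has edge-disjoint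
`T`-factors using all but boundedly many of these matchings. -/
lemma almostPackedByFactors_of_matchings [Finite K] [Finite U] (hT : T.IsTree) {τ : ℕ}
    {M V : Type*} [Fintype M] [Finite V] (e : Fin τ × M ≃ V) (G : SimpleGraph V) (k : ℕ) {D : ℕ}
    (hD0 : 0 < D)
    (hD : ∀ i j : Fin τ, i ≠ j → Nat.card {σ : K × U ≃ Fin τ // Hits T σ i j} = D)
    (hG : ∀ i j : Fin τ, i < j → ∃ π : Fin k → Equiv.Perm M,
      (∀ l a, G.Adj (e (i, a)) (e (j, π l a))) ∧ ∀ a, Function.Injective fun l => π l a)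
    {δ : ℝ} (hδ : (1 - δ) * (G.edgeSet.ncard : ℝ)
      ≤ (τ * (τ - 1) / 2 : ℝ) * (k - D) * Fintype.card M) :
    AlmostPackedByFactors T δ G := by
  classical
  -- Each placement receives `N` matchings from every pair of blocks it uses; rounding wastes fewer
  -- than `D` per pair.
  let N := k / D
  have hassign : ∀ i j : Fin τ, ∃ ψ : (K × U ≃ Fin τ) × Fin N → Equiv.Perm M, i < j →
      (∀ x, Hits T x.1 i j → ∀ a, G.Adj (e (i, a)) (e (j, ψ x a))) ∧
      ∀ x y a, Hits T x.1 i j → Hits T y.1 i j → ψ x a = ψ y a → x = y := by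
    intro i j
    by_cases hij : i < j
    swap
    · exact ⟨fun _ => 1, fun h => absurd h hij⟩
    obtain ⟨π, hπ, hinj⟩ := hG i j hij
    have : Fintype {σ : K × U ≃ Fin τ // Hits T σ i j} := Fintype.ofFinite _
    obtain ⟨ι⟩ : Nonempty ({σ : K × U ≃ Fin τ // Hits T σ i j} × Fin N ↪ Fin k) := by
      apply Function.Embedding.nonempty_of_card_le
      rw [Fintype.card_prod, ← Nat.card_eq_fintype_card, hD i j hij.ne, Fintype.card_fin,
        Fintype.card_fin]
      exact Nat.mul_div_le k D
    refine ⟨fun x => if h : Hits T x.1 i j then π (ι (⟨x.1, h⟩, x.2)) else 1, fun _ => ⟨?_, ?_⟩⟩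
    · intro x hx a
      simp only [hx, dif_pos]
      exact hπ _ _
    · intro x y a hx hy hxy
      simp only [hx, hy, dif_pos] at hxy
      have := ι.injective (hinj a hxy)
      simp only [Prod.mk.injEq, Subtype.mk.injEq] at this
      exact Prod.ext this.1 this.2
  choose ψ hψ using hassign
  -- Reversing a pair of blocks inverts its matching, which makes `g` skew-symmetric as
  -- `IsTree.exists_potential` requires.
  let g : Fin τ → Fin τ → (K × U ≃ Fin τ) × Fin N → Equiv.Perm M :=
    fun i j x => if i < j then ψ i j x else (ψ j i x)⁻¹
  have hg_lt : ∀ i j x, i < j → g i j x = ψ i j x := fun i j x h => if_pos h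
  have hg_inv : ∀ i j x, i ≠ j → g j i x = (g i j x)⁻¹ := by
    intro i j x hij
    rcases lt_or_gt_of_ne hij with h | h
    · simp [g, h, h.not_gt]
    · simp [g, h, h.not_gt]
  have h_inv : ∀ (ρ : Equiv.Perm M) a, ρ⁻¹ (ρ a) = a := fun ρ a => ρ.symm_apply_apply a
  have hg_adj : ∀ i j x, i ≠ j → Hits T x.1 i j → ∀ a, G.Adj (e (i, a)) (e (j, g i j x a)) := by
    intro i j x hij hx a
    rcases lt_or_gt_of_ne hij with h | h
    · rw [hg_lt _ _ _ h]; exact (hψ i j h).1 x hx a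
    · have := (hψ j i h).1 x hx.symm ((g i j x) a)
      rw [← hg_lt _ _ _ h, hg_inv i j x hij, h_inv] at this
      exact this.symm
  have hg_inj : ∀ i j x y a, i ≠ j → Hits T x.1 i j → Hits T y.1 i j →
      g i j x a = g i j y a → x = y := by
    intro i j x y a hij hx hy hxy
    rcases lt_or_gt_of_ne hij with h | h
    · rw [hg_lt _ _ _ h, hg_lt _ _ _ h] at hxy
      exact (hψ i j h).2 x y a hx hy hxy
    · refine (hψ j i h).2 x y (g i j x a) hx.symm hy.symm ?_
      rw [← hg_lt _ _ _ h, ← hg_lt _ _ _ h, hg_inv i j x hij, hg_inv i j y hij,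
        h_inv, hxy, h_inv]
  have hσne : ∀ (σ : K × U ≃ Fin τ) q u v, T.Adj u v → σ (q, u) ≠ σ (q, v) := by
    intro σ q u v huv
    simpa using huv.ne
  have hφ : ∀ (x : (K × U ≃ Fin τ) × Fin N) (q : K), ∃ φ : U → Equiv.Perm M,
      ∀ u v, T.Adj u v → φ v = g (x.1 (q, u)) (x.1 (q, v)) x * φ u := fun x q =>
    hT.exists_potential (fun u v => g (x.1 (q, u)) (x.1 (q, v)) x)
      fun u v huv => hg_inv _ _ _ (hσne _ _ _ _ huv)
  choose φ hφ using hφ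
  -- Indexing the covered edges by increasing pairs of blocks makes `ed` injective, so their number
  -- can be read off.
  let ix := (p : {p : Fin τ × Fin τ // p.1 < p.2}) ×
    ({σ : K × U ≃ Fin τ // Hits T σ p.1.1 p.1.2} × Fin N × M)
  let ed : ix → Sym2 V := fun z =>
    s(e (z.1.1.1, z.2.2.2), e (z.1.1.2, g z.1.1.1 z.1.1.2 (z.2.1.1, z.2.2.1) z.2.2.2))
  have hed : Function.Injective ed := by
    rintro ⟨⟨⟨i, j⟩, hij⟩, ⟨σ, hσ⟩, s, a⟩ ⟨⟨⟨i', j'⟩, hij'⟩, ⟨σ', hσ'⟩, s', a'⟩ h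
    simp only [ed, Sym2.eq_iff, EmbeddingLike.apply_eq_iff_eq, Prod.mk.injEq] at h
    simp only at hij hij' hσ hσ'
    rcases h with ⟨⟨rfl, rfl⟩, rfl, h⟩ | ⟨⟨rfl, -⟩, rfl, -⟩
    · have := hg_inj _ _ _ _ _ hij.ne hσ hσ' h
      simp only [Prod.mk.injEq] at this
      obtain ⟨rfl, rfl⟩ := this
      rfl
    · exact absurd hij hij'.not_gt
  refine almostPackedByFactors_of_tilings (K := K × M)
    (fun x : (K × U ≃ Fin τ) × Fin N => blowupTiling x.1 e (φ x)) ?_ ?_ (Set.range ed) ?_ ?_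
  · rintro x ⟨q, a⟩ u v huv
    simp only [blowupTiling_apply]
    rw [hφ x q u v huv, Equiv.Perm.mul_apply]
    exact hg_adj _ _ x (hσne _ _ _ _ huv) ⟨q, u, v, huv, rfl, rfl⟩ _
  · rintro x y ⟨q, a⟩ ⟨q', a'⟩ u v u' v' huv huv' h1 h2
    simp only [blowupTiling_apply, EmbeddingLike.apply_eq_iff_eq, Prod.mk.injEq] at h1 h2
    refine hg_inj (x.1 (q, u)) (x.1 (q, v)) x y (φ x q u a) (hσne _ _ _ _ huv)
      ⟨q, u, v, huv, rfl, rfl⟩ ⟨q', u', v', huv', h1.1.symm, h2.1.symm⟩ ?_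
    rw [← Equiv.Perm.mul_apply, ← hφ x q u v huv, h2.2, h1.2, h1.1, h2.1, ← Equiv.Perm.mul_apply,
      ← hφ y q' u' v' huv']
  · rintro _ ⟨⟨⟨⟨i, j⟩, hij⟩, ⟨σ, hσ⟩, s, a⟩, rfl⟩
    obtain ⟨q, u, v, huv, h1, h2⟩ := id hσ
    refine ⟨(σ, s), (q, (φ (σ, s) q u).symm a), u, v, huv, ?_⟩
    simp only [ed, blowupTiling_apply, Equiv.apply_symm_apply]
    rw [hφ (σ, s) q u v huv, Equiv.Perm.mul_apply, Equiv.apply_symm_apply]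
    simp only [h1, h2]
  · refine hδ.trans ?_
    have hcard : (Set.range ed).ncard = #{x : Fin τ × Fin τ | x.1 < x.2} *
        (D * (N * Fintype.card M)) := by
      rw [← Nat.card_coe_set_eq, Nat.card_range_of_injective hed, Nat.card_sigma,
        Finset.sum_congr rfl (g := fun _ => D * (N * Fintype.card M))]
      · rw [Finset.sum_const, Finset.card_univ, Fintype.card_subtype, smul_eq_mul]
      · intro p _
        rw [Nat.card_prod, Nat.card_prod, hD _ _ p.2.ne, Nat.card_eq_fintype_card,
          Nat.card_eq_fintype_card, Fintype.card_fin]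
    have hpairs : (#{x : Fin τ × Fin τ | x.1 < x.2} : ℝ) = τ * (τ - 1) / 2 := by
      have := card_prod_lt τ
      rcases Nat.eq_zero_or_pos τ with rfl | hτ
      · simp
      · have h2 : (#{x : Fin τ × Fin τ | x.1 < x.2} * 2 : ℝ) = τ * (τ - 1) := by
          have h3 : ((τ - 1 : ℕ) : ℝ) = τ - 1 := by push_cast [Nat.cast_sub hτ]; ring
          rw [← h3]; exact_mod_cast this
        linarith
    rw [hcard]
    push_cast
    rw [hpairs, mul_assoc]
    have hkD : (k : ℝ) - D ≤ D * N := by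
      have := Nat.lt_div_mul_add (a := k) hD0
      have h4 : (k : ℝ) < N * D + D := by exact_mod_cast this
      linarith
    have hnonneg : (0 : ℝ) ≤ τ * (τ - 1) / 2 := by rw [← hpairs]; positivity
    rw [← mul_assoc (D : ℝ)]
    gcongr

end Blowup
end SimpleGraph

namespace SimpleGraph
open MeasureTheory
open scoped Finset

/-! ### Many disjoint perfect matchings in a random bipartite graph -/

section RandomBipartite
variable {V M : Type*} [Fintype V] [DecidableEq V] (p : unitInterval)

lemma binomialRandom_real_card_adj_lt_le {a b : M → V} (ha : a.Injective) (hb : b.Injective)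
    (hab : ∀ x y, a x ≠ b y) {d : ℝ} (hd0 : 0 ≤ d) (hd : d ≤ 1) (X Y : Finset M) :
    (binomialRandom V p).real 
      {G | (({e | e ∈ X ×ˢ Y ∧ G.Adj (a e.1) (b e.2)} : Set (M × M)).ncard : ℝ)
        ≤ (1 - d) * (p * (#X * #Y))} ≤ Real.exp (- (d ^ 2 * (p * (#X * #Y)) / 4)) := by
  classical
  let f : M × M → Sym2 V := fun e => s(a e.1, b e.2)
  have hf : f.Injective := by
    rintro ⟨x, y⟩ ⟨x', y'⟩ h
    simp only [f, Sym2.eq_iff] at h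
    rcases h with ⟨h1, h2⟩ | ⟨h1, -⟩
    · rw [ha h1, hb h2]
    · exact absurd h1 (hab _ _)
  have h := binomialRandom_real_ncard_edgeSet_inter_le p ((X ×ˢ Y).image f) (by
    intro e he
    obtain ⟨x, -, rfl⟩ := Finset.mem_image.1 he
    simpa [f] using hab _ _) hd0 hd
  rw [Finset.card_image_of_injective _ hf, Finset.card_product] at h
  push_cast at h
  convert h using 7 with G
  rw [← Set.ncard_image_of_injective _ hf]
  congr 1
  ext e
  simp only [Set.mem_image, Set.mem_ofPred_eq, Set.mem_inter_iff, Finset.mem_product]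
  constructor
  · rintro ⟨x, ⟨hx, hadj⟩, rfl⟩
    exact ⟨hadj, x, hx, rfl⟩
  · rintro ⟨he, x, hx, rfl⟩
    exact ⟨x, ⟨hx, he⟩, rfl⟩

/-- Here `m - y < x` and `m < 2 * y`, so `(x + (m - y)) * m ≤ 4 * x * y`. The right side is a
product of powers in `x` and `m - y`, so the union bound over pairs of sets factors into two
binomial sums. -/
lemma exp_le_pow_add {m x y : ℕ} {c : ℝ} (hc : 0 ≤ c) (hxy : x ≤ y) (hy : y ≤ m) (h : m < x + y) :
    Real.exp (-(4 * c * (x * y))) ≤ Real.exp (-(c * m)) ^ (x + (m - y)) := by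
  rw [← Real.exp_nat_mul, Real.exp_le_exp]
  push_cast [Nat.cast_sub hy]
  have h1 : (x : ℝ) ≤ y := by exact_mod_cast hxy
  have h2 : (y : ℝ) ≤ m := by exact_mod_cast hy
  have h3 : (m : ℝ) < x + y := by exact_mod_cast h
  have h4 : (x + (m - y) : ℝ) * m ≤ 4 * (x * y) := by
    have : (x + (m - y) : ℝ) ≤ 2 * x := by linarith
    have h5 : (m : ℝ) ≤ 2 * y := by linarith
    nlinarith [Nat.cast_nonneg (α := ℝ) x, Nat.cast_nonneg (α := ℝ) y, Nat.cast_nonneg (α := ℝ) m,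
      mul_le_mul this h5 (Nat.cast_nonneg m) (by positivity)]
  nlinarith [mul_le_mul_of_nonneg_left h4 hc]

/-- The failure event for `k` disjoint perfect matchings between two classes of a random graph. -/
lemma binomialRandom_real_not_matchings_le [Fintype M] {a b : M → V} (ha : a.Injective) (hb : b.Injective)
    (hab : ∀ x y, a x ≠ b y) {d : ℝ} (hd0 : 0 ≤ d) (hd : d ≤ 1) (k : ℕ)
    (hk : (k : ℝ) ≤ (1 - d) * (p * Fintype.card M)) :
    (binomialRandom V p).real {G | ¬ ∃ π : Fin k → Equiv.Perm M,
      (∀ l x, G.Adj (a x) (b (π l x))) ∧ ∀ x, Function.Injective fun l => π l x}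
      ≤ 2 * ((1 + Real.exp (-(d ^ 2 * p / 16 * Fintype.card M))) ^ Fintype.card M - 1) *
        (1 + Real.exp (-(d ^ 2 * p / 16 * Fintype.card M))) ^ Fintype.card M := by
  classical
  set m := Fintype.card M with hm
  set r := Real.exp (-(d ^ 2 * p / 16 * m)) with hr
  have hp0 : (0 : ℝ) ≤ p := p.2.1
  have hr0 : 0 < r := Real.exp_pos _
  -- For all other pairs the Ore–Ryser condition is trivial.
  let pairs : Finset (Finset M × Finset M) := {z | m < #z.1 + #z.2}
  let bad : Finset M × Finset M → Set (SimpleGraph V) := fun z =>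
    {G | (({e | e ∈ z.1 ×ˢ z.2 ∧ G.Adj (a e.1) (b e.2)} : Set (M × M)).ncard : ℝ)
      ≤ (1 - d) * (p * (#z.1 * #z.2))}
  have hsub : {G : SimpleGraph V | ¬ ∃ π : Fin k → Equiv.Perm M,
      (∀ l x, G.Adj (a x) (b (π l x))) ∧ ∀ x, Function.Injective fun l => π l x}
      ⊆ ⋃ z ∈ pairs, bad z := by
    intro G hG
    by_contra hcon
    simp only [Set.mem_iUnion, not_exists] at hcon
    refine hG (exists_equivs_of_card_le (fun x y => G.Adj (a x) (b y)) k rfl fun X Y => ?_)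
    rw [← hm]
    by_cases hXY : m < #X + #Y
    swap
    · push Not at hXY
      exact (Nat.mul_le_mul_left k hXY).trans (Nat.le_add_left _ _)
    have h1 := hcon (X, Y) (by simpa [pairs] using hXY)
    simp only [bad, Set.mem_ofPred_eq, not_le] at h1
    have h2 : ({e | e ∈ X ×ˢ Y ∧ G.Adj (a e.1) (b e.2)} : Set (M × M)).ncard
        = #{e ∈ X ×ˢ Y | G.Adj (a e.1) (b e.2)} := by
      rw [← Set.ncard_coe_finset]; simp
    rw [h2] at h1
    have hx : (#X : ℝ) ≤ m := by exact_mod_cast Finset.card_le_univ X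
    have hy : (#Y : ℝ) ≤ m := by exact_mod_cast Finset.card_le_univ Y
    have hxy : (m : ℝ) < #X + #Y := by exact_mod_cast hXY
    have h3 : (k : ℝ) * (#X + #Y - m) ≤ (1 - d) * (p * (#X * #Y)) := by
      calc (k : ℝ) * (#X + #Y - m) ≤ (1 - d) * (p * m) * (#X + #Y - m) := by
            gcongr
        _ = (1 - d) * p * (m * (#X + #Y - m)) := by ring
        _ ≤ (1 - d) * p * (#X * #Y) := by
            have h0 : 0 ≤ 1 - d := by linarith
            -- This is `(m - #X) * (m - #Y) ≥ 0`.
            have h1 : (m : ℝ) * (#X + #Y - m) ≤ #X * #Y := by nlinarith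
            exact mul_le_mul_of_nonneg_left h1 (mul_nonneg h0 hp0)
        _ = _ := by ring
    have h4 : (k * (#X + #Y) : ℝ) ≤ #{e ∈ X ×ˢ Y | G.Adj (a e.1) (b e.2)} + k * m := by linarith
    exact_mod_cast h4
  refine (measureReal_mono hsub (measure_ne_top _ _)).trans ((measureReal_biUnion_finset_le pairs bad).trans ?_)
  -- Neither set of a pair in `pairs` is empty, so the empty set may get weight `0`. This produces
  -- the factor `(1 + r) ^ m - 1`, which is small, in place of `(1 + r) ^ m`.
  have hterm : ∀ z ∈ pairs, (binomialRandom V p).real (bad z) ≤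
      (if z.1 = ∅ then 0 else r ^ #z.1) * r ^ (m - #z.2) +
      r ^ (m - #z.1) * (if z.2 = ∅ then 0 else r ^ #z.2) := by
    rintro ⟨X, Y⟩ hz
    simp only [pairs, Finset.mem_filter, Finset.mem_univ, true_and] at hz
    have hx := Finset.card_le_univ X
    have hy := Finset.card_le_univ Y
    have hX : X ≠ ∅ := by rintro rfl; simp at hz; omega
    have hY : Y ≠ ∅ := by rintro rfl; simp at hz; omega
    refine (binomialRandom_real_card_adj_lt_le p ha hb hab hd0 hd X Y).trans ?_
    simp only [hX, hY, if_false]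
    have hc : 0 ≤ d ^ 2 * (p : ℝ) / 16 := by positivity
    rcases le_total (#X) (#Y) with h | h
    · have := exp_le_pow_add hc h hy hz
      rw [← hm, ← hr, pow_add] at this
      have h0 : 0 ≤ r ^ (m - #X) * r ^ #Y := by positivity
      refine le_trans (le_of_eq ?_) (this.trans (by linarith))
      congr 1; ring
    · have := exp_le_pow_add hc h hx (by rwa [add_comm])
      rw [← hm, ← hr, pow_add] at this
      have h0 : 0 ≤ r ^ #X * r ^ (m - #Y) := by positivity
      refine le_trans (le_of_eq ?_) (this.trans (by linarith))
      congr 1; ring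
  refine (Finset.sum_le_sum hterm).trans ((Finset.sum_le_univ_sum_of_nonneg ?_).trans
    (le_of_eq ?_))
  · intro z; positivity
  have hs1 : ∑ X : Finset M, (if X = ∅ then 0 else r ^ #X) = (1 + r) ^ m - 1 := by
    have h1 := Fintype.sum_pow_mul_eq_add_pow M r 1
    simp only [one_pow, mul_one] at h1
    rw [add_comm, hm, ← h1, ← Finset.add_sum_erase _ _ (Finset.mem_univ (∅ : Finset M)),
      ← Finset.add_sum_erase Finset.univ (fun X : Finset M => r ^ #X) (Finset.mem_univ ∅)]
    simp only [if_true, zero_add, Finset.card_empty, pow_zero, add_sub_cancel_left]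
    exact Finset.sum_congr rfl fun X hX => if_neg (Finset.ne_of_mem_erase hX)
  have hs2 : ∑ X : Finset M, r ^ (m - #X) = (1 + r) ^ m := by
    have h1 := Fintype.sum_pow_mul_eq_add_pow M 1 r
    simp only [one_pow, one_mul] at h1
    rw [hm, ← h1]
  rw [Finset.sum_add_distrib, Fintype.sum_prod_type, Fintype.sum_prod_type]
  simp only
  rw [← Fintype.sum_mul_sum, ← Fintype.sum_mul_sum, hs1, hs2]
  ring

lemma two_mul_one_add_pow_sub_one_mul_le {m n : ℕ} (hmn : m ≤ n) (hn : 0 < n) {r : ℝ} (hr0 : 0 ≤ r)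
    (hr : r ≤ 1 / (n : ℝ) ^ 2) : 2 * ((1 + r) ^ m - 1) * (1 + r) ^ m ≤ 12 / n := by
  have hn0 : (0 : ℝ) < n := by exact_mod_cast hn
  have hn1 : (1 : ℝ) ≤ n := by exact_mod_cast hn
  have hq : m * r ≤ 1 / n := by
    calc (m : ℝ) * r ≤ n * (1 / (n : ℝ) ^ 2) := by gcongr
      _ = 1 / n := by field_simp
  have hq1 : m * r ≤ 1 := hq.trans (by rw [div_le_one hn0]; exact hn1)
  have hq0 : 0 ≤ m * r := by positivity
  have h1 : (1 + r) ^ m ≤ Real.exp (m * r) := by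
    rw [Real.exp_nat_mul]
    gcongr
    linarith [Real.add_one_le_exp r]
  have h2 := (abs_le.1 (Real.abs_exp_sub_one_sub_id_le (abs_le.2 ⟨by linarith, hq1⟩))).2
  have h3 : (1 + r) ^ m ≤ 1 + 2 * (m * r) := by nlinarith
  have h4 : 1 ≤ (1 + r) ^ m := one_le_pow₀ (by linarith)
  calc 2 * ((1 + r) ^ m - 1) * (1 + r) ^ m ≤ 2 * (2 * (m * r)) * 3 := by
        gcongr <;> linarith
    _ = 12 * (m * r) := by ring
    _ ≤ 12 * (1 / n) := by gcongr
    _ = 12 / n := by ring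

lemma binomialRandom_real_edgeSet_large_le {d : ℝ} (hd0 : 0 ≤ d) (hd : d ≤ 1) :
    (binomialRandom V p).real
      {G | (1 + d) * (p * (Fintype.card V).choose 2) ≤ (G.edgeSet.ncard : ℝ)}
      ≤ Real.exp (- (d ^ 2 * (p * (Fintype.card V).choose 2) / 4)) := by
  have h := binomialRandom_real_le_ncard_edgeSet_inter p
    (Finset.univ.filter fun e : Sym2 V => ¬ e.IsDiag) (by simp) hd0 hd
  have hN : #(Finset.univ.filter fun e : Sym2 V => ¬ e.IsDiag) = (Fintype.card V).choose 2 := by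
    rw [← Sym2.card_subtype_not_diag, Fintype.card_subtype]
  rw [hN] at h
  convert h using 6 with G
  refine (congrArg Set.ncard (Set.inter_eq_left.2 fun e he => ?_)).symm
  simpa using G.not_isDiag_of_mem_edgeSet he

end RandomBipartite

/-! ### Failure probability and the count of lost edges -/

section Packing
variable {K U : Type*} {T : SimpleGraph U}

/-- The failure probability for an almost packing by `T`-factors on `τ * m` vertices. -/
lemma binomialRandom_real_not_almostPackedByFactors_le [Finite K] [Finite U] (hT : T.IsTree)
    {τ m D : ℕ} (hD0 : 0 < D)
    (hD : ∀ i j : Fin τ, i ≠ j → Nat.card {σ : K × U ≃ Fin τ // Hits T σ i j} = D)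
    {d : ℝ} (hd0 : 0 < d) (hd : d ≤ 1 / 4) (hτ : 1 ≤ d * τ) (p : unitInterval) (hn : 2 ≤ τ * m)
    (hp : 32 * τ / d ^ 2 * Real.log (τ * m : ℕ) ≤ p * (τ * m : ℕ))
    (hlog : 1 + (D : ℝ) ≤ Real.log (τ * m : ℕ)) :
    (binomialRandom (Fin (τ * m)) p).real {G | ¬ AlmostPackedByFactors T (4 * d) G}
      ≤ (12 * τ ^ 2 + 1) / (τ * m : ℕ) := by
  classical
  set n := τ * m with hnm
  have hτ0 : 0 < τ := Nat.pos_of_ne_zero fun h => by subst h; simp [hnm] at hn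
  have hp0 : (0 : ℝ) ≤ p := p.2.1
  have hτR : (0 : ℝ) < τ := by exact_mod_cast hτ0
  have hτ1 : (1 : ℝ) ≤ τ := by exact_mod_cast hτ0
  have hn0 : (0 : ℝ) < n := Nat.cast_pos.2 (by omega)
  have hn2 : (2 : ℝ) ≤ n := by exact_mod_cast hn
  have hnR : (n : ℝ) = τ * m := by rw [hnm]; push_cast; ring
  have hlog0 : 0 < Real.log n := Real.log_pos (by linarith)
  have hp' : 32 * τ * Real.log n ≤ d ^ 2 * (p * n) := by
    have h1 := mul_le_mul_of_nonneg_left hp (sq_nonneg d)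
    have h2 : d ^ 2 * (32 * τ / d ^ 2 * Real.log n) = 32 * τ * Real.log n := by field_simp
    rwa [h2] at h1
  -- The constant `32` makes `d ^ 2 * p * m / 16` at least `2 * log n`, so the weight `r` of the
  -- union bound is at most `1 / n ^ 2`.
  have hpm : 32 * Real.log n ≤ d ^ 2 * (p * m) := by
    rw [hnR] at hp'
    have : τ * (32 * Real.log (τ * m : ℝ)) ≤ τ * (d ^ 2 * (p * m)) := by nlinarith
    rw [hnR]
    exact le_of_mul_le_mul_left this hτR
  set k := ⌊(1 - d) * (p * m)⌋₊ with hk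
  have hk0 : 0 ≤ (1 - d) * (p * m : ℝ) := by
    have : 0 ≤ 1 - d := by linarith
    positivity
  have hkle : (k : ℝ) ≤ (1 - d) * (p * m) := Nat.floor_le hk0
  have hklt : (1 - d) * (p * m : ℝ) < k + 1 := Nat.lt_floor_add_one _
  let e : Fin τ × Fin m ≃ Fin n := finProdFinEquiv
  let badPair : Fin τ × Fin τ → Set (SimpleGraph (Fin n)) := fun ij =>
    {G | ¬ ∃ π : Fin k → Equiv.Perm (Fin m), (∀ l x, G.Adj (e (ij.1, x)) (e (ij.2, π l x))) ∧
      ∀ x, Function.Injective fun l => π l x}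
  let dense : Set (SimpleGraph (Fin n)) :=
    {G | (1 + d) * (p * (Fintype.card (Fin n)).choose 2) ≤ (G.edgeSet.ncard : ℝ)}
  let pairs : Finset (Fin τ × Fin τ) := {ij | ij.1 < ij.2}
  have hsub : {G : SimpleGraph (Fin n) | ¬ AlmostPackedByFactors T (4 * d) G} ⊆
      (⋃ ij ∈ pairs, badPair ij) ∪ dense := by
    intro G hG
    by_contra hcon
    simp only [Set.mem_union, Set.mem_iUnion, not_or, not_exists] at hcon
    obtain ⟨h1, h2⟩ := hcon
    refine hG (almostPackedByFactors_of_matchings hT e G k hD0 hD (fun i j hij => ?_) ?_)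
    · have := h1 (i, j) (by simpa [pairs] using hij)
      simpa [badPair] using this
    · simp only [dense, Set.mem_ofPred_eq, not_le, Fintype.card_fin, Nat.cast_choose_two] at h2
      rw [Fintype.card_fin]
      -- The floor and the leftover matchings cost at most `1 + D ≤ log n ≤ d * p * m`.
      have hkD : (1 - 2 * d) * (p * m) ≤ (k : ℝ) - D := by
        have h3 : d ^ 2 * (p * m) ≤ d * (p * m : ℝ) := by
          have : d ^ 2 ≤ d := by nlinarith
          gcongr
        nlinarith
      have hA : (0 : ℝ) ≤ p * n ^ 2 / 2 := by positivity
      -- The losses combine through `(1 - 4 * d) * (1 + d) ≤ (1 - d) * (1 - 2 * d)`, and `1 - d ≤ (τ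
      -- - 1) / τ` pays for the edges inside blocks.
      calc (1 - 4 * d) * (G.edgeSet.ncard : ℝ)
          ≤ (1 - 4 * d) * ((1 + d) * (p * (n * (n - 1) / 2))) :=
            mul_le_mul_of_nonneg_left h2.le (by linarith)
        _ ≤ (1 - 4 * d) * ((1 + d) * (p * n ^ 2 / 2)) := by
            refine mul_le_mul_of_nonneg_left (mul_le_mul_of_nonneg_left ?_ (by linarith))
              (by linarith)
            nlinarith [mul_nonneg hp0 hn0.le]
        _ ≤ ((1 - d) * (1 - 2 * d)) * (p * n ^ 2 / 2) := by
            rw [← mul_assoc]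
            refine mul_le_mul_of_nonneg_right ?_ hA
            nlinarith
        _ ≤ (τ * (τ - 1) / τ ^ 2) * (1 - 2 * d) * (p * n ^ 2 / 2) := by
            refine mul_le_mul_of_nonneg_right (mul_le_mul_of_nonneg_right ?_ (by linarith)) hA
            rw [le_div_iff₀ (by positivity)]
            nlinarith
        _ = (τ * (τ - 1) / 2) * ((1 - 2 * d) * (p * m)) * m := by
            rw [hnR]; field_simp
        _ ≤ (τ * (τ - 1) / 2) * (k - D) * m := by
            have : (0 : ℝ) ≤ τ - 1 := by linarith
            gcongr
  have hpair : ∀ ij ∈ pairs, (binomialRandom (Fin n) p).real (badPair ij) ≤ 12 / n := by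
    rintro ⟨i, j⟩ hij
    have hij : i < j := by simpa [pairs] using hij
    refine (binomialRandom_real_not_matchings_le p (a := fun x => e (i, x)) (b := fun x => e (j, x))
      (fun x y h => by simpa using h) (fun x y h => by simpa using h)
      (fun x y h => hij.ne (by simpa using congrArg Prod.fst (e.injective h))) hd0.le
      (by linarith) k (by simpa using hkle)).trans
      (two_mul_one_add_pow_sub_one_mul_le ?_ (by omega) (Real.exp_pos _).le ?_)
    · rw [Fintype.card_fin, hnm]; exact Nat.le_mul_of_pos_left m hτ0
    · rw [Fintype.card_fin, Real.exp_neg, ← one_div]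
      refine one_div_le_one_div_of_le (by positivity) ?_
      rw [← Real.exp_log hn0, ← Real.exp_nat_mul, Real.exp_le_exp]
      push_cast
      linarith
  have hdense : (binomialRandom (Fin n) p).real dense ≤ 1 / n := by
    refine (binomialRandom_real_edgeSet_large_le p hd0.le (by linarith)).trans ?_
    rw [Fintype.card_fin, Nat.cast_choose_two, Real.exp_neg, ← one_div]
    refine one_div_le_one_div_of_le hn0 ?_
    conv_lhs => rw [← Real.exp_log hn0]
    rw [Real.exp_le_exp]
    have h1 : 32 * Real.log n ≤ d ^ 2 * (p * n) := by nlinarith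
    have h2 : 32 * Real.log n * 1 ≤ d ^ 2 * (p * n) * (n - 1) :=
      mul_le_mul h1 (by linarith) zero_le_one (by positivity)
    nlinarith
  have hcard : (#pairs : ℝ) ≤ τ ^ 2 := by
    have : #pairs ≤ τ ^ 2 := (Finset.card_le_univ _).trans (by simp [sq])
    exact_mod_cast this
  calc (binomialRandom (Fin n) p).real {G | ¬ AlmostPackedByFactors T (4 * d) G}
      ≤ (binomialRandom (Fin n) p).real (⋃ ij ∈ pairs, badPair ij)
        + (binomialRandom (Fin n) p).real dense :=
        (measureReal_mono hsub (measure_ne_top _ _)).trans (measureReal_union_le _ _)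
    _ ≤ #pairs * (12 / n) + 1 / n := by
        refine add_le_add ((measureReal_biUnion_finset_le _ _).trans ?_) hdense
        rw [← nsmul_eq_mul]
        exact Finset.sum_le_card_nsmul _ _ _ hpair
    _ ≤ τ ^ 2 * (12 / n) + 1 / n := by gcongr
    _ = (12 * τ ^ 2 + 1) / n := by ring

lemma almostPackedByFactors_of_one_le {V : Type*} (G : SimpleGraph V) {δ : ℝ} (hδ : 1 ≤ δ) :
    AlmostPackedByFactors T δ G := by
  refine ⟨∅, by simp, by simp, ?_⟩
  simpa using le_mul_of_one_le_left (Nat.cast_nonneg G.edgeSet.ncard) hδ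

end Packing
end SimpleGraph

/-! ### The main theorem -/

open SimpleGraph MeasureTheory in
theorem theorem3 :
    ∃ M : ℝ, 0 < M ∧
      ∀ (t : ℕ) (T : SimpleGraph (Fin t)), 2 ≤ t → T.IsTree →
      ∀ ε : ℝ, 0 < ε →
      ∃ τ₀ : ℕ, ∀ τ : ℕ, τ₀ ≤ τ → t ∣ τ →
      ∃ C : ℝ, ∀ p : ℕ → unitInterval,
        (∀ᶠ n : ℕ in atTop, τ ∣ n → C * Real.log n / n < (p n : ℝ)) →
        Tendsto
          (fun n : ℕ => SimpleGraph.binomialRandom (Fin n) (p n)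
            {G | AlmostPackedByFactors T (M * ε) G})
          (atTop ⊓ 𝓟 {n : ℕ | τ ∣ n}) (𝓝 1) := by
  refine ⟨4, by norm_num, fun t T ht hT ε hε => ?_⟩
  -- For `ε > 1 / 4` the allowed fraction exceeds `1`, and the empty family works.
  rcases lt_or_ge (1 / 4) ε with hε4 | hε4
  · refine ⟨0, fun τ _ _ => ⟨0, fun p _ => ?_⟩⟩
    have : ∀ n : ℕ, {G : SimpleGraph (Fin n) | AlmostPackedByFactors T (4 * ε) G} = Set.univ :=
      fun n => Set.eq_univ_of_forall fun G => almostPackedByFactors_of_one_le G (by linarith)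
    simp only [this, measure_univ]
    exact tendsto_const_nhds
  refine ⟨⌈1 / ε⌉₊, fun τ hτ htτ => ⟨32 * τ / ε ^ 2, fun p hp => ?_⟩⟩
  have hτε : 1 ≤ ε * τ := by
    have := (Nat.le_ceil (1 / ε)).trans (Nat.cast_le.2 hτ)
    rwa [div_le_iff₀' hε] at this
  have hτ0 : 0 < τ := Nat.pos_of_ne_zero fun h => by rw [h] at hτε; norm_num at hτε
  obtain ⟨Q, rfl⟩ := htτ
  have hQ : 0 < Q := Nat.pos_of_mul_pos_left hτ0
  have : Nonempty (Fin Q) := ⟨⟨0, hQ⟩⟩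
  have : Nontrivial (Fin t) := Fin.nontrivial_iff_two_le.2 ht
  obtain ⟨u₀, v₀, h₀⟩ : ∃ u v, T.Adj u v := by
    obtain ⟨u, v, huv⟩ := exists_pair_ne (Fin t)
    obtain ⟨w⟩ := hT.connected.preconnected u v
    exact ⟨_, _, w.adj_snd (w.not_nil_of_ne huv)⟩
  -- Divisibility of `τ` by `t` lets `Q` copies of `T` fill the blocks exactly. As `D` does not
  -- depend on `n`, `1 + D ≤ log n` holds eventually.
  obtain ⟨D, hD0, hD⟩ := exists_card_hits (K := Fin Q) (B := Fin (t * Q))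
    ⟨Fintype.equivOfCardEq (by simp [mul_comm])⟩ h₀
  have hlog : ∀ᶠ n : ℕ in atTop, 1 + (D : ℝ) ≤ Real.log n :=
    (Real.tendsto_log_atTop.comp tendsto_natCast_atTop_atTop).eventually_ge_atTop _
  have hlow : Tendsto (fun n : ℕ => ENNReal.ofReal (1 - (12 * ((t * Q : ℕ) : ℝ) ^ 2 + 1) / n))
      (atTop ⊓ 𝓟 {n : ℕ | t * Q ∣ n}) (𝓝 1) := by
    have h1 := (tendsto_const_div_atTop_nhds_zero_nat (12 * ((t * Q : ℕ) : ℝ) ^ 2 + 1)).const_sub 1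
    have h2 := ENNReal.tendsto_ofReal h1
    rw [sub_zero, ENNReal.ofReal_one] at h2
    exact h2.mono_left inf_le_left
  refine tendsto_of_tendsto_of_tendsto_of_le_of_le' hlow tendsto_const_nhds ?_
    (Eventually.of_forall fun n => prob_le_one)
  rw [eventually_inf_principal]
  filter_upwards [hp, hlog, eventually_ge_atTop 2] with n hpn hlogn hn2 hdvd
  have hpn := hpn hdvd
  obtain ⟨m, rfl⟩ := hdvd
  have hn0 : (0 : ℝ) < (t * Q * m : ℕ) := by
    have : 0 < t * Q * m := by omega
    exact_mod_cast this
  rw [div_lt_iff₀ hn0] at hpn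
  have hfail := binomialRandom_real_not_almostPackedByFactors_le hT hD0 hD hε hε4 hτε
    (p (t * Q * m)) hn2 hpn.le hlogn
  refine ENNReal.ofReal_le_of_le_toReal ?_
  -- Subadditivity suffices to pass to the complement, without measurability of the event.
  have hunion := measureReal_union_le (μ := binomialRandom (Fin (t * Q * m)) (p (t * Q * m)))
    {G | AlmostPackedByFactors T (4 * ε) G} {G | ¬ AlmostPackedByFactors T (4 * ε) G}
  have huniv : {G : SimpleGraph (Fin (t * Q * m)) | AlmostPackedByFactors T (4 * ε) G} ∪
      {G | ¬ AlmostPackedByFactors T (4 * ε) G} = Set.univ := by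
    ext G; simp [em]
  rw [huniv, probReal_univ] at hunion
  rw [measureReal_def] at hunion
  linarith
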